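/- Let $d, K \ge 1$ be integers, let $p_1, \dots, p_K \in (0,1]$ with $\sum_{k=1}^K p_k = 1$, and let $\sigma_1, \dots, \sigma_K \in (0,1]$ with $\sigma_1 = 1$. Write $\sigma := \min_{1 \le k \le K} \sigma_k$ and let $\phi(t) = (2\pi)^{-1/2} e^{-t^2/2}$ be the standard normal density. Suppose that the $\mathbb{R}^d$-valued random vector $T = (T_1, \dots, T_d)$ has Lebesgue density $$f(x_1, \dots, x_d) = \prod_{j=1}^d \left( \sum_{k=1}^K \frac{p_k}{\sigma_k}\, \phi\!\left(\frac{x_j}{\sigma_k}\right) \right),$$ that is, $T_1, \dots, T_d$ are i.i.d. with a $K$-component centred Gaussian mixture distribution. Then for all $x \in \mathbb{R}$ and all $\varepsilon \ge 0$, $$\mathbb{P}\left( x < \max_{1 \le j \le d} T_j \le x + \varepsilon \right) \le \min\left\{ \frac{\varepsilon}{p_1} \left( \sqrt{2 \log d} + 2 \sum_{k=1}^K \frac{p_k}{\sigma_k} \right),\ \frac{\varepsilon}{\sigma} \left( \sqrt{2 \log d} + 2 \right) \right\}.$$ -/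

import Mathlib

open MeasureTheory ProbabilityTheory

/-- The density on `ℝ^d` of a vector with i.i.d. coordinates, each distributed as a centred
Gaussian mixture with weights `p k` and standard deviations `σ k`:
`x ↦ ∏ j, ∑ k, (p k / σ k) * φ (x j / σ k)`, where `φ` is the standard normal density. -/
noncomputable def gaussianMixtureDensity {d K : ℕ} (p σ : Fin K → ℝ) (x : Fin d → ℝ) : ℝ :=
  ∏ j : Fin d, ∑ k : Fin K, p k / σ k * gaussianPDFReal 0 1 (x j / σ k)

/-! Let `F` and `f` be the distribution function and density of one coordinate. The maximum has
distribution function `F ^ d`, so by the mean value inequality it suffices to bound `d * F ^ (d - 1)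
* f` uniformly. The engine is `d * F ^ (d - 1) * (1 - F) ≤ 1`: wherever `f ≤ c * (1 - F)`, the
density of the maximum is at most `c`. A Mills ratio estimate supplies such `c` up to the level `√(2
* log d)`; beyond it `d * φ ≤ 1`. The bound in `σ` applies this dichotomy to each component at its
own argument `x / σ k`. The bound in `p 0` compares `f` with the component of unit variance, which
carries at least the fraction `p 0` of the tail `1 - Φ(x)`. -/

/-- The distribution function of the standard normal distribution. -/
noncomputable def stdNormalCDF (t : ℝ) : ℝ :=
  ∫ u in Set.Iic t, gaussianPDFReal 0 1 u

/-! ### Standard normal density, distribution function and tail -/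

lemma gaussianPDFReal_zero_one (t : ℝ) :
    gaussianPDFReal 0 1 t = (√(2 * Real.pi))⁻¹ * Real.exp (-t ^ 2 / 2) := by
  simp [gaussianPDFReal]

lemma hasDerivAt_gaussianPDFReal_zero_one (t : ℝ) :
    HasDerivAt (gaussianPDFReal 0 1) (-t * gaussianPDFReal 0 1 t) t := by
  have h1 : HasDerivAt (fun u : ℝ => -u ^ 2 / 2) (-t) t := by
    have := ((hasDerivAt_pow 2 t).neg).div_const 2
    refine this.congr_deriv ?_
    simp
    ring
  have h := (h1.exp).const_mul (√(2 * Real.pi))⁻¹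
  rw [show gaussianPDFReal 0 1 = fun u => (√(2 * Real.pi))⁻¹ * Real.exp (-u ^ 2 / 2) from
    funext gaussianPDFReal_zero_one]
  refine h.congr_deriv ?_
  ring

lemma continuous_gaussianPDFReal_zero_one : Continuous (gaussianPDFReal 0 1) :=
  continuous_iff_continuousAt.2 fun t => (hasDerivAt_gaussianPDFReal_zero_one t).continuousAt

lemma gaussianPDFReal_zero_one_anti_sq {s t : ℝ} (h : s ^ 2 ≤ t ^ 2) :
    gaussianPDFReal 0 1 t ≤ gaussianPDFReal 0 1 s := by
  rw [gaussianPDFReal_zero_one, gaussianPDFReal_zero_one]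
  gcongr

lemma gaussianPDFReal_zero_one_le_exp (t : ℝ) :
    gaussianPDFReal 0 1 t ≤ Real.exp (-t ^ 2 / 2) := by
  rw [gaussianPDFReal_zero_one]
  have h : 1 ≤ √(2 * Real.pi) := by
    rw [Real.one_le_sqrt]
    linarith [Real.pi_gt_three]
  exact mul_le_of_le_one_left (Real.exp_nonneg _) (inv_le_one_of_one_le₀ h)

lemma tendsto_gaussianPDFReal_zero_one_atTop :
    Filter.Tendsto (gaussianPDFReal 0 1) Filter.atTop (nhds 0) := by
  refine squeeze_zero' (Filter.Eventually.of_forall fun t => gaussianPDFReal_nonneg 0 1 t)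
    (g := fun t => Real.exp (-(t / 2))) ?_
    (Real.tendsto_exp_neg_atTop_nhds_zero.comp (Filter.tendsto_id.atTop_div_const two_pos))
  filter_upwards [Filter.eventually_ge_atTop 1] with t ht
  refine (gaussianPDFReal_zero_one_le_exp t).trans (Real.exp_le_exp.2 ?_)
  nlinarith

lemma hasDerivAt_stdNormalCDF (t : ℝ) :
    HasDerivAt stdNormalCDF (gaussianPDFReal 0 1 t) t := by
  have hi := integrable_gaussianPDFReal 0 1
  have h : stdNormalCDF = fun u => stdNormalCDF 0 + ∫ v in (0 : ℝ)..u, gaussianPDFReal 0 1 v := by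
    funext u
    rw [← intervalIntegral.integral_Iic_sub_Iic hi.integrableOn hi.integrableOn]
    simp [stdNormalCDF]
  rw [h]
  exact (continuous_gaussianPDFReal_zero_one.integral_hasStrictDerivAt 0 t).hasDerivAt.const_add _

lemma one_sub_stdNormalCDF (t : ℝ) :
    1 - stdNormalCDF t = ∫ u in Set.Ioi t, gaussianPDFReal 0 1 u := by
  have hi := integrable_gaussianPDFReal 0 1
  rw [← integral_gaussianPDFReal_eq_one 0 one_ne_zero,
    ← intervalIntegral.integral_Iic_add_Ioi hi.integrableOn (hi.integrableOn (s := Set.Ioi t)),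
    stdNormalCDF, add_sub_cancel_left]

lemma stdNormalCDF_nonneg (t : ℝ) : 0 ≤ stdNormalCDF t :=
  integral_nonneg fun _ => gaussianPDFReal_nonneg 0 1 _

lemma stdNormalCDF_le_one (t : ℝ) : stdNormalCDF t ≤ 1 := by
  rw [← sub_nonneg, one_sub_stdNormalCDF]
  exact integral_nonneg fun _ => gaussianPDFReal_nonneg 0 1 _

lemma monotone_stdNormalCDF : Monotone stdNormalCDF :=
  monotone_of_hasDerivAt_nonneg hasDerivAt_stdNormalCDF
    fun _ => gaussianPDFReal_nonneg 0 1 _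

lemma tendsto_stdNormalCDF_atBot :
    Filter.Tendsto stdNormalCDF Filter.atBot (nhds 0) :=
  tendsto_integral_Iic_zero Filter.tendsto_id

/-- A bound of Mills ratio type for nonnegative arguments. -/
lemma gaussianPDFReal_div_le_one_sub_stdNormalCDF {t : ℝ} (ht : 0 ≤ t) :
    gaussianPDFReal 0 1 t / (t + 1) ≤ 1 - stdNormalCDF t := by
  -- The derivative of `Φ + φ / (u + 1)` simplifies to `φ * u / (u + 1) ^ 2 ≥ 0`; the bound follows
  -- by comparison with `1 + φ(u)` as `u → ∞`.
  have hmono : MonotoneOn (fun u => stdNormalCDF u + gaussianPDFReal 0 1 u / (u + 1))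
      (Set.Ici 0) := by
    have hd : ∀ u ∈ Set.Ici (0 : ℝ),
        HasDerivAt (fun u => stdNormalCDF u + gaussianPDFReal 0 1 u / (u + 1))
          (gaussianPDFReal 0 1 u * (u / (u + 1) ^ 2)) u := by
      intro u hu
      have hu1 : u + 1 ≠ 0 := by
        have : (0 : ℝ) ≤ u := hu
        positivity
      refine ((hasDerivAt_stdNormalCDF u).add ((hasDerivAt_gaussianPDFReal_zero_one u).div
        ((hasDerivAt_id' u).add_const 1) hu1)).congr_deriv ?_
      field_simp
      ring
    refine monotoneOn_of_deriv_nonneg (convex_Ici 0)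
      (fun u hu => (hd u hu).continuousAt.continuousWithinAt)
      (fun u hu => (hd u (interior_subset hu)).differentiableAt.differentiableWithinAt) ?_
    intro u hu
    have hu' := interior_subset hu
    rw [(hd u hu').deriv]
    have : (0 : ℝ) ≤ u := hu'
    exact mul_nonneg (gaussianPDFReal_nonneg 0 1 u) (by positivity)
  have hle : ∀ u ∈ Set.Ici t,
      stdNormalCDF t + gaussianPDFReal 0 1 t / (t + 1) ≤ 1 + gaussianPDFReal 0 1 u := by
    intro u hu
    have hu0 : 0 ≤ u := ht.trans hu
    refine (hmono ht hu0 hu).trans (add_le_add (stdNormalCDF_le_one u) ?_)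
    exact div_le_self (gaussianPDFReal_nonneg 0 1 u) (by linarith)
  have hlim : Filter.Tendsto (fun u => 1 + gaussianPDFReal 0 1 u) Filter.atTop (nhds (1 + 0)) :=
    tendsto_gaussianPDFReal_zero_one_atTop.const_add 1
  have := ge_of_tendsto hlim ((Filter.eventually_ge_atTop t).mono hle)
  linarith

/-- Extends the Mills bound to negative `t` through `φ(t) ≤ φ(0) ≤ 1 - Φ(0) ≤ 1 - Φ(t)`, giving one
constant on a whole half-line. -/
lemma gaussianPDFReal_le_mul_one_sub_stdNormalCDF {s t : ℝ} (hs : 0 ≤ s) (hts : t ≤ s) :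
    gaussianPDFReal 0 1 t ≤ (s + 1) * (1 - stdNormalCDF t) := by
  have hS := sub_nonneg.2 (stdNormalCDF_le_one t)
  rcases le_total 0 t with ht | ht
  · have h := gaussianPDFReal_div_le_one_sub_stdNormalCDF ht
    rw [div_le_iff₀ (by linarith)] at h
    nlinarith
  · have h := gaussianPDFReal_div_le_one_sub_stdNormalCDF le_rfl
    rw [zero_add, div_one] at h
    have h1 : gaussianPDFReal 0 1 t ≤ gaussianPDFReal 0 1 0 :=
      gaussianPDFReal_zero_one_anti_sq (by simpa using sq_nonneg t)
    have h2 := monotone_stdNormalCDF ht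
    nlinarith

/-! ### Estimates absorbing the factor `d` -/

lemma natCast_mul_gaussianPDFReal_le_one {d : ℕ} (hd : d ≠ 0) {t : ℝ}
    (ht : √(2 * Real.log d) ≤ t) : d * gaussianPDFReal 0 1 t ≤ 1 := by
  have hd' : (0 : ℝ) < d := by exact_mod_cast Nat.pos_of_ne_zero hd
  have hsq : 2 * Real.log d ≤ t ^ 2 := (Real.sqrt_le_left ((Real.sqrt_nonneg _).trans ht)).1 ht
  calc d * gaussianPDFReal 0 1 t ≤ d * Real.exp (-Real.log d) := by
        gcongr
        refine (gaussianPDFReal_zero_one_le_exp t).trans (Real.exp_le_exp.2 ?_)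
        linarith
    _ = 1 := by rw [Real.exp_neg, Real.exp_log hd', mul_inv_cancel₀ hd'.ne']

/-- Each of the `d` terms of `∑ F ^ i = (1 - F ^ d) / (1 - F)` is at least `F ^ (d - 1)`.
Probabilistically, the left side is the chance that exactly one of `d` independent copies exceeds
the level. -/
lemma natCast_mul_one_sub_mul_pow_le_one {F : ℝ} (h0 : 0 ≤ F) (h1 : F ≤ 1) (d : ℕ) :
    d * F ^ (d - 1) * (1 - F) ≤ 1 := by
  have h : (d : ℝ) * F ^ (d - 1) ≤ ∑ i ∈ Finset.range d, F ^ i := by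
    have h := Finset.card_nsmul_le_sum (Finset.range d) (fun i => F ^ i) (F ^ (d - 1)) fun i hi =>
      pow_le_pow_of_le_one h0 h1 (Nat.le_sub_one_of_lt (Finset.mem_range.1 hi))
    rwa [Finset.card_range, nsmul_eq_mul] at h
  have hg := geom_sum_mul F d
  have := mul_le_mul_of_nonneg_right h (sub_nonneg.2 h1)
  nlinarith [pow_nonneg h0 d]

/-! ### One-dimensional Gaussian mixtures -/

/-- The density of a centred Gaussian mixture on the real line. -/
noncomputable def gaussianMixturePDF {K : ℕ} (p σ : Fin K → ℝ) (x : ℝ) : ℝ :=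
  ∑ k, p k / σ k * gaussianPDFReal 0 1 (x / σ k)

/-- The distribution function of a centred Gaussian mixture on the real line. -/
noncomputable def gaussianMixtureCDF {K : ℕ} (p σ : Fin K → ℝ) (x : ℝ) : ℝ :=
  ∑ k, p k * stdNormalCDF (x / σ k)

section Mixture

variable {K : ℕ} {p σ : Fin K → ℝ}

lemma gaussianMixturePDF_nonneg (hp : ∀ k, 0 ≤ p k) (hσ : ∀ k, 0 < σ k) (x : ℝ) :
    0 ≤ gaussianMixturePDF p σ x :=
  Finset.sum_nonneg fun k _ =>
    mul_nonneg (div_nonneg (hp k) (hσ k).le) (gaussianPDFReal_nonneg 0 1 _)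

lemma continuous_gaussianMixturePDF : Continuous (gaussianMixturePDF p σ) :=
  continuous_finsetSum _ fun _ _ =>
    continuous_const.mul (continuous_gaussianPDFReal_zero_one.comp (continuous_id.div_const _))

lemma integrable_gaussianMixturePDF (hσ : ∀ k, 0 < σ k) :
    Integrable (gaussianMixturePDF p σ) :=
  integrable_finsetSum _ fun k _ =>
    ((integrable_gaussianPDFReal 0 1).comp_div (hσ k).ne').const_mul _

lemma hasDerivAt_gaussianMixtureCDF (x : ℝ) :
    HasDerivAt (gaussianMixtureCDF p σ) (gaussianMixturePDF p σ x) x := by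
  refine (HasDerivAt.fun_sum fun k _ => (((hasDerivAt_stdNormalCDF (x / σ k)).comp x
    ((hasDerivAt_id' x).div_const (σ k))).const_mul (p k))).congr_deriv ?_
  exact Finset.sum_congr rfl fun k _ => by ring

lemma setIntegral_Iic_gaussianMixturePDF (hσ : ∀ k, 0 < σ k) (x : ℝ) :
    ∫ u in Set.Iic x, gaussianMixturePDF p σ u = gaussianMixtureCDF p σ x := by
  have hlim : Filter.Tendsto (gaussianMixtureCDF p σ) Filter.atBot (nhds (∑ k, p k * 0)) :=
    tendsto_finsetSum _ fun k _ => (tendsto_stdNormalCDF_atBot.comp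
      (Filter.tendsto_id.atBot_div_const (hσ k))).const_mul _
  rw [integral_Iic_of_hasDerivAt_of_tendsto' (fun u _ => hasDerivAt_gaussianMixtureCDF u)
    (integrable_gaussianMixturePDF hσ).integrableOn hlim]
  simp

lemma gaussianMixtureCDF_nonneg (hp : ∀ k, 0 ≤ p k) (x : ℝ) : 0 ≤ gaussianMixtureCDF p σ x :=
  Finset.sum_nonneg fun k _ => mul_nonneg (hp k) (stdNormalCDF_nonneg _)

lemma one_sub_gaussianMixtureCDF (hp_sum : ∑ k, p k = 1) (x : ℝ) :
    1 - gaussianMixtureCDF p σ x = ∑ k, p k * (1 - stdNormalCDF (x / σ k)) := by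
  simp_rw [mul_sub, mul_one, Finset.sum_sub_distrib, hp_sum, gaussianMixtureCDF]

lemma gaussianMixtureCDF_le_one (hp : ∀ k, 0 ≤ p k) (hp_sum : ∑ k, p k = 1) (x : ℝ) :
    gaussianMixtureCDF p σ x ≤ 1 := by
  rw [← sub_nonneg, one_sub_gaussianMixtureCDF hp_sum]
  exact Finset.sum_nonneg fun k _ => mul_nonneg (hp k) (sub_nonneg.2 (stdNormalCDF_le_one _))

/-! ### Uniform bounds on the density of the maximum -/

/-- The density of the maximum of `d` independent copies is bounded in terms of any lower bound
on the standard deviations. -/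
lemma natCast_mul_pow_mul_gaussianMixturePDF_le_div {d : ℕ} (hd : d ≠ 0) (hp : ∀ k, 0 ≤ p k)
    (hp_sum : ∑ k, p k = 1) {s : ℝ} (hs : 0 < s) (hsσ : ∀ k, s ≤ σ k) (x : ℝ) :
    d * gaussianMixtureCDF p σ x ^ (d - 1) * gaussianMixturePDF p σ x ≤
      (√(2 * Real.log d) + 2) / s := by
  set F := gaussianMixtureCDF p σ x with hF
  set r := √(2 * Real.log d)
  have hr : 0 ≤ r := Real.sqrt_nonneg _
  have hF0 : 0 ≤ F := gaussianMixtureCDF_nonneg hp x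
  have hF1 : F ≤ 1 := gaussianMixtureCDF_le_one hp hp_sum x
  have hpow : F ^ (d - 1) ≤ 1 := pow_le_one₀ hF0 hF1
  set A := (d : ℝ) * F ^ (d - 1) with hA
  have hA0 : 0 ≤ A := by positivity
  have hterm : ∀ k, A * gaussianPDFReal 0 1 (x / σ k) ≤
      1 + (r + 1) * (A * (1 - stdNormalCDF (x / σ k))) := by
    intro k
    have hS := sub_nonneg.2 (stdNormalCDF_le_one (x / σ k))
    have hφ := gaussianPDFReal_nonneg 0 1 (x / σ k)
    -- The threshold is applied to `x / σ k`, so different components may fall in different cases;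
    -- adding the two bounds covers both.
    rcases le_total (x / σ k) r with h | h
    · have := mul_le_mul_of_nonneg_left (gaussianPDFReal_le_mul_one_sub_stdNormalCDF hr h) hA0
      linarith
    · have h1 := natCast_mul_gaussianPDFReal_le_one hd h
      have h2 : A * gaussianPDFReal 0 1 (x / σ k) ≤ d * gaussianPDFReal 0 1 (x / σ k) := by
        rw [hA]
        gcongr
        exact mul_le_of_le_one_right (Nat.cast_nonneg d) hpow
      have h3 : 0 ≤ (r + 1) * (A * (1 - stdNormalCDF (x / σ k))) := by positivity
      linarith
  have hbin : A * (1 - F) ≤ 1 := natCast_mul_one_sub_mul_pow_le_one hF0 hF1 d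
  calc A * gaussianMixturePDF p σ x
      = ∑ k, p k / σ k * (A * gaussianPDFReal 0 1 (x / σ k)) := by
        rw [gaussianMixturePDF, Finset.mul_sum]
        exact Finset.sum_congr rfl fun k _ => by ring
    _ ≤ ∑ k, p k / s * (1 + (r + 1) * (A * (1 - stdNormalCDF (x / σ k)))) := by
        refine Finset.sum_le_sum fun k _ => ?_
        have hφ := gaussianPDFReal_nonneg 0 1 (x / σ k)
        exact mul_le_mul (div_le_div_of_nonneg_left (hp k) hs (hsσ k)) (hterm k)
          (by positivity) (div_nonneg (hp k) hs.le)
    _ = (1 + (r + 1) * (A * (1 - F))) / s := by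
        have hsum : ∑ k, p k / s * (1 + (r + 1) * (A * (1 - stdNormalCDF (x / σ k)))) =
            (∑ k, p k + (r + 1) * (A * ∑ k, p k * (1 - stdNormalCDF (x / σ k)))) / s := by
          rw [Finset.mul_sum, Finset.mul_sum, ← Finset.sum_add_distrib, Finset.sum_div]
          exact Finset.sum_congr rfl fun k _ => by ring
        rw [hsum, hp_sum, hF, one_sub_gaussianMixtureCDF hp_sum]
    _ ≤ (r + 2) / s := by
        refine div_le_div_of_nonneg_right ?_ hs.le
        nlinarith

/-- With `a = 1 / s ≥ 1` the claim is `a ≤ exp (x ^ 2 * (a ^ 2 - 1) / 2)`. As `x ≥ 1`, the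
exponential is at least `1 + (a ^ 2 - 1) / 2`, which exceeds `a` by `(a - 1) ^ 2 / 2`. For `0 ≤ x <
1` it fails when `s` is close to `1`. -/
lemma gaussianPDFReal_div_div_le {s x : ℝ} (hs : 0 < s) (hs1 : s ≤ 1) (hx : 1 ≤ x) :
    gaussianPDFReal 0 1 (x / s) / s ≤ gaussianPDFReal 0 1 x := by
  have ha : 1 ≤ s⁻¹ := (one_le_inv₀ hs).2 hs1
  have hkey : s⁻¹ ≤ Real.exp (x ^ 2 * (s⁻¹ ^ 2 - 1) / 2) := by
    refine le_trans ?_ (Real.add_one_le_exp _)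
    have h2 : 0 ≤ s⁻¹ ^ 2 - 1 := by nlinarith
    have h3 : 1 ≤ x ^ 2 := by nlinarith
    nlinarith [mul_nonneg h2 (sub_nonneg.2 h3), sq_nonneg (s⁻¹ - 1)]
  rw [gaussianPDFReal_zero_one, gaussianPDFReal_zero_one, mul_div_assoc]
  refine mul_le_mul_of_nonneg_left ?_ (by positivity)
  calc Real.exp (-(x / s) ^ 2 / 2) / s = s⁻¹ * Real.exp (-(x / s) ^ 2 / 2) := by
        rw [div_eq_inv_mul]
    _ ≤ Real.exp (x ^ 2 * (s⁻¹ ^ 2 - 1) / 2) * Real.exp (-(x / s) ^ 2 / 2) := by gcongr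
    _ = Real.exp (-x ^ 2 / 2) := by
        rw [← Real.exp_add, div_eq_mul_inv x s]
        congr 1
        ring

/-- The density of the maximum of `d` independent copies is bounded in terms of the weight of
any component with standard deviation `1`. -/
lemma natCast_mul_pow_mul_gaussianMixturePDF_le_weight {d : ℕ} (hd : d ≠ 0)
    (hp : ∀ k, 0 ≤ p k) (hp_sum : ∑ k, p k = 1) (hσ : ∀ k, σ k ∈ Set.Ioc (0 : ℝ) 1)
    {i : Fin K} (hpi : 0 < p i) (hσi : σ i = 1) (x : ℝ) :
    d * gaussianMixtureCDF p σ x ^ (d - 1) * gaussianMixturePDF p σ x ≤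
      (√(2 * Real.log d) + 2 * ∑ k, p k / σ k) / p i := by
  set F := gaussianMixtureCDF p σ x with hF
  set r := √(2 * Real.log d)
  set C := ∑ k, p k / σ k with hC
  have hr : 0 ≤ r := Real.sqrt_nonneg _
  have hF0 : 0 ≤ F := gaussianMixtureCDF_nonneg hp x
  have hF1 : F ≤ 1 := gaussianMixtureCDF_le_one hp hp_sum x
  have hpow : F ^ (d - 1) ≤ 1 := pow_le_one₀ hF0 hF1
  have hC1 : 1 ≤ C := by
    rw [← hp_sum, hC]
    exact Finset.sum_le_sum fun k _ => le_div_self (hp k) (hσ k).1 (hσ k).2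
  have hpi1 : p i ≤ 1 := by
    rw [← hp_sum]
    exact Finset.single_le_sum (fun k _ => hp k) (Finset.mem_univ i)
  have hφ : ∀ k, gaussianPDFReal 0 1 (x / σ k) ≤ gaussianPDFReal 0 1 x := by
    intro k
    refine gaussianPDFReal_zero_one_anti_sq ?_
    rw [div_pow]
    exact le_div_self (sq_nonneg x) (pow_pos (hσ k).1 2) (pow_le_one₀ (hσ k).1.le (hσ k).2)
  have hfC : gaussianMixturePDF p σ x ≤ C * gaussianPDFReal 0 1 x := by
    rw [gaussianMixturePDF, hC, Finset.sum_mul]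
    exact Finset.sum_le_sum fun k _ =>
      mul_le_mul_of_nonneg_left (hφ k) (div_nonneg (hp k) (hσ k).1.le)
  have hf0 : 0 ≤ gaussianMixturePDF p σ x := gaussianMixturePDF_nonneg hp (fun k => (hσ k).1) x
  set A := (d : ℝ) * F ^ (d - 1) with hA
  have hA0 : 0 ≤ A := by positivity
  rw [le_div_iff₀ hpi]
  rcases le_total r x with hx | hx
  · have h1 := natCast_mul_gaussianPDFReal_le_one hd hx
    have hAd : A ≤ d := mul_le_of_le_one_right (Nat.cast_nonneg d) hpow
    calc A * gaussianMixturePDF p σ x * p i ≤ A * gaussianMixturePDF p σ x :=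
          mul_le_of_le_one_right (by positivity) hpi1
      _ ≤ d * (C * gaussianPDFReal 0 1 x) := by gcongr
      _ = C * (d * gaussianPDFReal 0 1 x) := by ring
      _ ≤ C * 1 := by gcongr
      _ ≤ r + 2 * C := by linarith
  · have hS := sub_nonneg.2 (stdNormalCDF_le_one x)
    have hfS : gaussianMixturePDF p σ x ≤ (r + 2 * C) * (1 - stdNormalCDF x) := by
      -- For `x ≥ 1` every scaled component lies below `φ(x)`, so `C` does not multiply `r`; for `x
      -- ≤ 1` the factor `C` is paid, but the Mills constant is only `2`.
      rcases le_total 1 x with h1 | h1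
      · have hf : gaussianMixturePDF p σ x ≤ gaussianPDFReal 0 1 x := by
          calc gaussianMixturePDF p σ x
              = ∑ k, p k * (gaussianPDFReal 0 1 (x / σ k) / σ k) :=
                Finset.sum_congr rfl fun k _ => by ring
            _ ≤ ∑ k, p k * gaussianPDFReal 0 1 x :=
                Finset.sum_le_sum fun k _ => mul_le_mul_of_nonneg_left
                  (gaussianPDFReal_div_div_le (hσ k).1 (hσ k).2 h1) (hp k)
            _ = gaussianPDFReal 0 1 x := by rw [← Finset.sum_mul, hp_sum, one_mul]
        refine hf.trans ((gaussianPDFReal_le_mul_one_sub_stdNormalCDF hr hx).trans ?_)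
        gcongr
        linarith
      · have h := gaussianPDFReal_le_mul_one_sub_stdNormalCDF zero_le_one h1
        calc gaussianMixturePDF p σ x ≤ C * gaussianPDFReal 0 1 x := hfC
          _ ≤ C * ((1 + 1) * (1 - stdNormalCDF x)) := by gcongr
          _ = (2 * C) * (1 - stdNormalCDF x) := by ring
          _ ≤ (r + 2 * C) * (1 - stdNormalCDF x) := by
            gcongr
            linarith
    -- Only the `i`-th tail is kept; `σ i = 1` makes its argument `x`.
    have hSi : p i * (1 - stdNormalCDF x) ≤ 1 - F := by
      rw [hF, one_sub_gaussianMixtureCDF hp_sum]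
      have := Finset.single_le_sum (f := fun k => p k * (1 - stdNormalCDF (x / σ k)))
        (fun k _ => mul_nonneg (hp k) (sub_nonneg.2 (stdNormalCDF_le_one _))) (Finset.mem_univ i)
      simpa [hσi] using this
    have hbin : A * (1 - F) ≤ 1 := natCast_mul_one_sub_mul_pow_le_one hF0 hF1 d
    calc A * gaussianMixturePDF p σ x * p i
        ≤ A * ((r + 2 * C) * (1 - stdNormalCDF x)) * p i := by gcongr
      _ = (r + 2 * C) * (A * (p i * (1 - stdNormalCDF x))) := by ring
      _ ≤ (r + 2 * C) * (A * (1 - F)) := by gcongr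
      _ ≤ (r + 2 * C) * 1 := by gcongr
      _ = r + 2 * C := mul_one _

/-! ### Law of the maximum and the mean value inequality -/

/-- The distribution function of the maximum of `d` independent copies. -/
lemma setIntegral_gaussianMixtureDensity {d : ℕ} (hσ : ∀ k, 0 < σ k) (y : ℝ) :
    ∫ z in Set.univ.pi (fun _ : Fin d => Set.Iic y), gaussianMixtureDensity p σ z =
      gaussianMixtureCDF p σ y ^ d := by
  rw [← integral_indicator (MeasurableSet.univ_pi fun _ => measurableSet_Iic),
    ← setIntegral_Iic_gaussianMixturePDF hσ, ← integral_indicator measurableSet_Iic]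
  -- Writing the exponent as a cardinality matches Fubini for a product of identical factors, here
  -- the density cut off at `y`.
  conv_rhs => rw [← Fintype.card_fin d]
  rw [← integral_fintype_prod_volume_eq_pow]
  congr 1
  funext z
  by_cases hz : z ∈ Set.univ.pi (fun _ : Fin d => Set.Iic y)
  · rw [Set.indicator_of_mem hz, gaussianMixtureDensity]
    exact Finset.prod_congr rfl fun j _ =>
      (Set.indicator_of_mem (hz j (Set.mem_univ j)) (gaussianMixturePDF p σ)).symm
  · rw [Set.indicator_of_notMem hz]
    obtain ⟨j, hj⟩ : ∃ j, z j ∉ Set.Iic y := by simpa only [Set.mem_pi, Set.mem_univ, true_implies, not_forall] using hz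
    exact (Finset.prod_eq_zero (Finset.mem_univ j) (Set.indicator_of_notMem hj _)).symm

lemma gaussianMixtureDensity_nonneg {d : ℕ} (hp : ∀ k, 0 ≤ p k) (hσ : ∀ k, 0 < σ k)
    (z : Fin d → ℝ) : 0 ≤ gaussianMixtureDensity p σ z :=
  Finset.prod_nonneg fun j _ => gaussianMixturePDF_nonneg hp hσ (z j)

lemma continuous_gaussianMixtureDensity {d : ℕ} :
    Continuous (gaussianMixtureDensity p σ : (Fin d → ℝ) → ℝ) :=
  continuous_finsetProd _ fun j _ =>
    (continuous_gaussianMixturePDF (p := p) (σ := σ)).comp (continuous_apply j)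

lemma measureReal_preimage_pi_Iic {Ω : Type*} [MeasurableSpace Ω] {μ : Measure Ω} {d : ℕ}
    (hp : ∀ k, 0 ≤ p k) (hσ : ∀ k, 0 < σ k) {T : Ω → Fin d → ℝ} (hT : AEMeasurable T μ)
    (hT_density : μ.map T =
      volume.withDensity (fun y : Fin d → ℝ => ENNReal.ofReal (gaussianMixtureDensity p σ y)))
    (y : ℝ) :
    μ.real (T ⁻¹' Set.univ.pi fun _ => Set.Iic y) = gaussianMixtureCDF p σ y ^ d := by
  have hB : MeasurableSet (Set.univ.pi fun _ : Fin d => Set.Iic y) :=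
    MeasurableSet.univ_pi fun _ => measurableSet_Iic
  rw [← setIntegral_gaussianMixtureDensity hσ, Measure.real, ← Measure.map_apply_of_aemeasurable
    hT hB, hT_density, withDensity_apply _ hB, integral_eq_lintegral_of_nonneg_ae
    (Filter.Eventually.of_forall fun z => gaussianMixtureDensity_nonneg hp hσ z)
    continuous_gaussianMixtureDensity.aestronglyMeasurable]

lemma gaussianMixtureCDF_pow_sub_le {d : ℕ} {C : ℝ}
    (hC : ∀ x, d * gaussianMixtureCDF p σ x ^ (d - 1) * gaussianMixturePDF p σ x ≤ C)
    {x y : ℝ} (hxy : x ≤ y) :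
    gaussianMixtureCDF p σ y ^ d - gaussianMixtureCDF p σ x ^ d ≤ C * (y - x) := by
  have hd : ∀ x, HasDerivAt (fun x => gaussianMixtureCDF p σ x ^ d)
      (d * gaussianMixtureCDF p σ x ^ (d - 1) * gaussianMixturePDF p σ x) x :=
    fun x => (hasDerivAt_gaussianMixtureCDF x).fun_pow d
  exact image_sub_le_mul_sub_of_deriv_le (fun x => (hd x).differentiableAt)
    (fun x => (hd x).deriv ▸ hC x) hxy

end Mixture

theorem mainTheorem7 {Ω : Type*} [MeasurableSpace Ω] (μ : Measure Ω) [IsProbabilityMeasure μ]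
    (d K : ℕ) [NeZero d] [NeZero K] (p σ : Fin K → ℝ)
    (hp : ∀ k, p k ∈ Set.Ioc (0 : ℝ) 1) (hp_sum : ∑ k, p k = 1)
    (hσ : ∀ k, σ k ∈ Set.Ioc (0 : ℝ) 1) (hσ_one : σ 0 = 1)
    (T : Ω → Fin d → ℝ) (hT : AEMeasurable T μ)
    (hT_density : μ.map T =
      volume.withDensity (fun y : Fin d → ℝ => ENNReal.ofReal (gaussianMixtureDensity p σ y)))
    (x ε : ℝ) (hε : 0 ≤ ε) :
    μ.real {ω | x < Finset.univ.sup' Finset.univ_nonempty (fun j : Fin d => T ω j) ∧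
        Finset.univ.sup' Finset.univ_nonempty (fun j : Fin d => T ω j) ≤ x + ε} ≤
      min (ε / p 0 * (√(2 * Real.log d) + 2 * ∑ k, p k / σ k))
        (ε / Finset.univ.inf' Finset.univ_nonempty σ * (√(2 * Real.log d) + 2)) := by

  have hxε : x ≤ x + ε := by linarith
  have hp0 : ∀ k, 0 ≤ p k := fun k => (hp k).1.le
  have hσ0 : ∀ k, 0 < σ k := fun k => (hσ k).1
  have hset : {ω | x < Finset.univ.sup' Finset.univ_nonempty (fun j : Fin d => T ω j) ∧
      Finset.univ.sup' Finset.univ_nonempty (fun j : Fin d => T ω j) ≤ x + ε} =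
      -- The maximum is at most `y` exactly when `T` lies in the box `(-∞, y] ^ d`, so the event is
      -- a difference of nested boxes.
      (T ⁻¹' Set.univ.pi fun _ => Set.Iic (x + ε)) \ (T ⁻¹' Set.univ.pi fun _ => Set.Iic x) := by
    ext ω
    simp only [Set.mem_ofPred_eq, Set.mem_sdiff, Set.mem_preimage, Set.mem_pi, Set.mem_univ,
      true_implies, Set.mem_Iic, Finset.sup'_le_iff, Finset.lt_sup'_iff, Finset.mem_univ,
      true_and, not_forall, not_le]
    exact and_comm
  have hprob : μ.real {ω | x < Finset.univ.sup' Finset.univ_nonempty (fun j : Fin d => T ω j) ∧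
      Finset.univ.sup' Finset.univ_nonempty (fun j : Fin d => T ω j) ≤ x + ε} =
      gaussianMixtureCDF p σ (x + ε) ^ d - gaussianMixtureCDF p σ x ^ d := by
    have hsub : (T ⁻¹' Set.univ.pi fun _ => Set.Iic x) ⊆
        T ⁻¹' Set.univ.pi fun _ => Set.Iic (x + ε) :=
      Set.preimage_mono (Set.pi_mono fun _ _ => Set.Iic_subset_Iic.2 hxε)
    have hmeas : NullMeasurableSet (T ⁻¹' Set.univ.pi fun _ => Set.Iic x) μ :=
      hT.nullMeasurable (MeasurableSet.univ_pi fun _ => measurableSet_Iic)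
    rw [hset, ← measureReal_preimage_pi_Iic hp0 hσ0 hT hT_density,
      ← measureReal_preimage_pi_Iic hp0 hσ0 hT hT_density, Measure.real,
      measure_sdiff hsub hmeas (measure_ne_top μ _),
      ENNReal.toReal_sub_of_le (measure_mono hsub) (measure_ne_top μ _)]
    rfl
  have hs : 0 < Finset.univ.inf' Finset.univ_nonempty σ :=
    (Finset.lt_inf'_iff _).2 fun k _ => hσ0 k
  rw [hprob]
  refine le_min ((gaussianMixtureCDF_pow_sub_le
    (natCast_mul_pow_mul_gaussianMixturePDF_le_weight (NeZero.ne d) hp0 hp_sum hσ (hp 0).1 hσ_one)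
    hxε).trans_eq ?_) ((gaussianMixtureCDF_pow_sub_le
    (natCast_mul_pow_mul_gaussianMixturePDF_le_div (NeZero.ne d) hp0 hp_sum hs
      fun k => Finset.inf'_le _ (Finset.mem_univ k)) hxε).trans_eq ?_)
  all_goals ring
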